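/- Let ${\bf T} = T_0T_1T_2\cdots = 0102010010201\cdots$ be the infinite Tribonacci word, the fixed point starting with $0$ of the morphism $0\to 01$, $1\to 02$, $2\to 0$. A border of a finite word $x$ is a nonempty proper prefix of $x$ that is also a suffix of $x$; $x$ is unbordered if it has no border (in particular the empty word is unbordered). Let $t_0=0$, $t_1=t_2=1$, $t_n=t_{n-1}+t_{n-2}+t_{n-3}$ for $n \ge 3$ be the Tribonacci numbers. For $n\ge 0$ let $(n)_T$ be the canonical Tribonacci representation of $n$: the unique binary word $a_1a_2\cdots a_k$ with no leading zero and no occurrence of $111$ such that $n=\sum_{i=1}^{k} a_i t_{k+2-i}$ (so $(0)_T$ is the empty word). Let $A$ be the deterministic finite automaton with input alphabet $\{0,1\}$, states $0,1,\ldots,24$, initial state $0$, accepting states $0,1,2,3,4,5,6,8,10,11,12,14,15,17$, and the following transitions, where $q:\ a,b$ means that $\delta(q,0)=a$ and $\delta(q,1)=b$ (the state $7$ is a dead state): $$\begin{array}{lllll} 0:\ 0,1 & 1:\ 2,3 & 2:\ 4,5 & 3:\ 6,7 & 4:\ 8,9\\ 5:\ 10,3 & 6:\ 11,12 & 7:\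 7,7 & 8:\ 8,7 & 9:\ 13,3\\ 10:\ 14,15 & 11:\ 8,16 & 12:\ 17,3 & 13:\ 18,5 & 14:\ 8,19\\ 15:\ 8,20 & 16:\ 21,8 & 17:\ 22,15 & 18:\ 7,9 & 19:\ 23,3\\ 20:\ 21,7 & 21:\ 24,12 & 22:\ 7,19 & 23:\ 22,15 & 24:\ 7,16 \end{array}$$ Theorem. For every integer $n\ge 0$, the word ${\bf T}$ has an unbordered factor of length $n$ if and only if $(n)_T$ is accepted by $A$. -/

import Mathlib

/-! ### The infinite Tribonacci word -/

/-- The morphism `0 ↦ 01`, `1 ↦ 02`, `2 ↦ 0` on letters. -/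
def tribMorphism : Fin 3 → List (Fin 3) := ![[0, 1], [0, 2], [0]]

/-- The `k`-th iterate of the morphism applied to the one-letter word `0`. -/
def tribIter : ℕ → List (Fin 3)
  | 0 => [0]
  | k + 1 => (tribIter k).flatMap tribMorphism

/-- The infinite Tribonacci word `T = 0102010010201⋯`, the fixed point of the morphism, as the
limit of the iterates: its letter of index `n` is the letter of index `n` of the `n`-th iterate
(which is long enough, and is a prefix of all later iterates, see below). -/
def tribWord (n : ℕ) : Fin 3 := (tribIter n).getD n 0

/-- `T[i..i+n-1]`, the factor of length `n` of the Tribonacci word starting at position `i`. -/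
def tribFactor (i n : ℕ) : List (Fin 3) := (List.range n).map fun j => tribWord (i + j)

/-- `x` is a (finite) factor of the Tribonacci word. -/
def IsTribFactor (x : List (Fin 3)) : Prop := ∃ i, x = tribFactor i x.length

theorem tribIter_prefix_succ (k : ℕ) : tribIter k <+: tribIter (k + 1) := by
  induction k with
  | zero => exact ⟨[1], rfl⟩
  | succ k ih =>
    obtain ⟨s, hs⟩ := ih
    refine ⟨s.flatMap tribMorphism, ?_⟩
    change (tribIter k).flatMap tribMorphism ++ _ = (tribIter (k + 1)).flatMap tribMorphism
    rw [← hs, List.flatMap_append]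

theorem tribIter_prefix {k l : ℕ} (h : k ≤ l) : tribIter k <+: tribIter l := by
  induction l, h using Nat.le_induction with
  | base => exact List.prefix_rfl
  | succ l _ ih => exact ih.trans (tribIter_prefix_succ l)

theorem length_le_length_flatMap_trib (x : List (Fin 3)) :
    x.length ≤ (x.flatMap tribMorphism).length := by
  induction x with
  | nil => simp
  | cons a x ih =>
    have : 1 ≤ (tribMorphism a).length := by fin_cases a <;> decide
    simp only [List.flatMap_cons, List.length_append, List.length_cons]
    omega

theorem lt_length_tribIter (k : ℕ) : k < (tribIter k).length := by
  induction k with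
  | zero => decide
  | succ k ih =>
    obtain ⟨s, hs⟩ := tribIter_prefix (Nat.zero_le k)
    have h1 := length_le_length_flatMap_trib s
    have h2 : tribIter (k + 1) = ([0, 1] : List (Fin 3)) ++ s.flatMap tribMorphism := by
      change (tribIter k).flatMap tribMorphism = _
      rw [← hs]; rfl
    rw [← hs] at ih
    rw [h2]
    simp only [tribIter, List.length_append, List.length_cons, List.length_nil] at *
    omega

/-- Every iterate of the morphism on `0` is a prefix of the Tribonacci word. -/
theorem tribIter_eq_tribFactor (k : ℕ) : tribIter k = tribFactor 0 (tribIter k).length := by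
  apply List.ext_getElem
  · simp [tribFactor]
  · intro n h1 h2
    have hn := lt_length_tribIter n
    simp only [tribFactor, List.getElem_map, List.getElem_range, Nat.zero_add, tribWord,
      List.getD_eq_getElem _ _ hn]
    rcases le_total k n with h | h
    · exact (tribIter_prefix h).getElem h1
    · exact ((tribIter_prefix h).getElem hn).symm

/-! ### Borders -/

/-- `y` is a border of `x`: a nonempty proper prefix of `x` that is also a suffix of `x`. -/
def IsBorder {α : Type*} (y x : List α) : Prop := y ≠ [] ∧ y ≠ x ∧ y <+: x ∧ y <:+ x

/-- A word is unbordered if it has no border. -/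
def IsUnbordered {α : Type*} (x : List α) : Prop := ¬ ∃ y, IsBorder y x

/-! ### Tribonacci representation -/

/-- The Tribonacci numbers `T₀ = 0`, `T₁ = 1`, `T₂ = 1`, `Tₙ = Tₙ₋₁ + Tₙ₋₂ + Tₙ₋₃`. -/
def tribNum : ℕ → ℕ
  | 0 => 0
  | 1 => 1
  | 2 => 1
  | n + 3 => tribNum (n + 2) + tribNum (n + 1) + tribNum n

/-- The value `[a₁ a₂ ⋯ aₙ]_T = ∑ aᵢ Tₙ₊₂₋ᵢ` of a binary word, most significant digit first. -/
def tribVal : List (Fin 2) → ℕ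
  | [] => 0
  | a :: w => a.val * tribNum (w.length + 2) + tribVal w

/-- A binary word is canonical if it has no leading zero and no occurrence of `111`. -/
def IsTribCanonical (w : List (Fin 2)) : Prop := w.head? ≠ some 0 ∧ ¬ [1, 1, 1] <:+: w

/-- The `k` digits, of weights `Tₖ₊₁, …, T₂`, that the greedy algorithm finds for `n`. -/
def tribGreedy : ℕ → ℕ → List (Fin 2)
  | 0, _ => []
  | k + 1, n =>
    if tribNum (k + 2) ≤ n then 1 :: tribGreedy k (n - tribNum (k + 2)) else 0 :: tribGreedy k n

/-- The canonical Tribonacci representation `(n)_T`, computed by the greedy algorithm and stripped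
of its leading zeros. It is the unique canonical word of value `n`, see `tribRep_eq_iff`. -/
def tribRep (n : ℕ) : List (Fin 2) := (tribGreedy n n).dropWhile (· == 0)

theorem tribNum_succ_pos (k : ℕ) : 0 < tribNum (k + 1) := by
  induction k using tribNum.induct with
  | case1 => decide
  | case2 => decide
  | case3 => decide
  | case4 n h1 h2 h3 => rw [tribNum]; omega

theorem le_tribNum_succ (k : ℕ) : k ≤ tribNum (k + 1) := by
  induction k using tribNum.induct with
  | case1 => decide
  | case2 => decide
  | case3 => decide
  | case4 n h1 h2 h3 =>
    have h4 : tribNum (n + 4) = tribNum (n + 3) + tribNum (n + 2) + tribNum (n + 1) := rfl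
    have h5 : 0 < tribNum (n + 2) := tribNum_succ_pos (n + 1)
    change n + 2 ≤ tribNum (n + 3) at h1
    change n + 3 ≤ tribNum (n + 4)
    omega

theorem lt_tribNum_add_two (k : ℕ) : k < tribNum (k + 2) := le_tribNum_succ (k + 1)

theorem length_tribGreedy (k n : ℕ) : (tribGreedy k n).length = k := by
  induction k generalizing n with
  | zero => rfl
  | succ k ih => rw [tribGreedy]; split_ifs <;> simp [ih]

theorem tribNum_add_two_le (k : ℕ) : tribNum (k + 3) ≤ 2 * tribNum (k + 2) := by
  cases k with
  | zero => decide
  | succ k =>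
    have h1 : tribNum (k + 4) = tribNum (k + 3) + tribNum (k + 2) + tribNum (k + 1) := rfl
    have h2 : tribNum (k + 3) = tribNum (k + 2) + tribNum (k + 1) + tribNum k := rfl
    change tribNum (k + 4) ≤ 2 * tribNum (k + 3)
    omega

theorem tribVal_tribGreedy (k n : ℕ) (h : n < tribNum (k + 2)) : tribVal (tribGreedy k n) = n := by
  induction k generalizing n with
  | zero =>
    have : tribNum (0 + 2) = 1 := rfl
    simp only [tribGreedy, tribVal]; omega
  | succ k ih =>
    have := tribNum_add_two_le k
    change n < tribNum (k + 3) at h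
    rw [tribGreedy]
    split_ifs with hk
    · simp only [tribVal, length_tribGreedy]
      rw [ih _ (by omega)]; simp; omega
    · simp only [tribVal]
      rw [ih _ (by omega)]; simp

theorem tribGreedy_no_one (k n : ℕ) (h : n < tribNum (k + 1)) : ¬ [1] <+: tribGreedy k n := by
  cases k with
  | zero => simp [tribGreedy]
  | succ k =>
    change n < tribNum (k + 2) at h
    rw [tribGreedy, if_neg (by omega)]
    simp

theorem tribGreedy_no_one_one (k n : ℕ) (h : n < tribNum (k + 1) + tribNum k) :
    ¬ [1, 1] <+: tribGreedy k n := by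
  cases k with
  | zero => simp [tribGreedy]
  | succ k =>
    change n < tribNum (k + 2) + tribNum (k + 1) at h
    rw [tribGreedy]
    split_ifs with hk
    · have := tribGreedy_no_one k (n - tribNum (k + 2)) (by omega)
      simpa [List.cons_prefix_cons] using this
    · simp

theorem tribGreedy_no_111 (k n : ℕ) (h : n < tribNum (k + 2)) :
    ¬ [1, 1, 1] <:+: tribGreedy k n := by
  induction k generalizing n with
  | zero => simp [tribGreedy]
  | succ k ih =>
    have h2 := tribNum_add_two_le k
    have h3 : tribNum (k + 3) = tribNum (k + 2) + tribNum (k + 1) + tribNum k := rfl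
    change n < tribNum (k + 3) at h
    rw [tribGreedy]
    split_ifs with hk
    · rw [List.infix_cons_iff, not_or]
      refine ⟨?_, ih _ (by omega)⟩
      have := tribGreedy_no_one_one k (n - tribNum (k + 2)) (by omega)
      simpa [List.cons_prefix_cons] using this
    · rw [List.infix_cons_iff, not_or]
      exact ⟨by simp, ih _ (by omega)⟩

theorem tribVal_dropWhile (w : List (Fin 2)) : tribVal (w.dropWhile (· == 0)) = tribVal w := by
  induction w with
  | nil => rfl
  | cons a w ih =>
    rw [List.dropWhile_cons]
    split_ifs with ha
    · have : a = 0 := by simpa using ha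
      simp [tribVal, ih, this]
    · rfl

/-- `(n)_T` has value `n`. -/
theorem tribVal_tribRep (n : ℕ) : tribVal (tribRep n) = n := by
  rw [tribRep, tribVal_dropWhile, tribVal_tribGreedy n n (lt_tribNum_add_two n)]

/-- `(n)_T` is canonical. -/
theorem isTribCanonical_tribRep (n : ℕ) : IsTribCanonical (tribRep n) := by
  refine ⟨fun h => ?_, fun h => ?_⟩
  · have := List.head?_dropWhile_not (fun a : Fin 2 => a == 0) (tribGreedy n n)
    rw [tribRep] at h
    rw [h] at this
    simp at this
  · exact tribGreedy_no_111 n n (lt_tribNum_add_two n)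
      (h.trans (List.dropWhile_suffix _).isInfix)

theorem tribVal_lt_one (w : List (Fin 2)) (h3 : ¬ [1, 1, 1] <:+: w) :
    tribVal w < tribNum (w.length + 2) ∧
      (¬ [1, 1] <+: w → tribVal w < tribNum (w.length + 1) + tribNum w.length) ∧
      (¬ [1] <+: w → tribVal w < tribNum (w.length + 1)) := by
  induction w with
  | nil => simp [tribVal, tribNum]
  | cons a w ih =>
    rw [List.infix_cons_iff, not_or] at h3
    obtain ⟨i1, i2, i3⟩ := ih h3.2
    have e : tribNum (w.length + 3) =
      tribNum (w.length + 2) + tribNum (w.length + 1) + tribNum w.length := rfl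
    simp only [List.length_cons, tribVal]
    rw [show w.length + 1 + 2 = w.length + 3 from rfl, show w.length + 1 + 1 = w.length + 2 from rfl]
    obtain rfl | rfl : a = 0 ∨ a = 1 := by omega
    · simp; omega
    · simp only [List.cons_prefix_cons, true_and, List.nil_prefix, not_true_eq_false,
        false_implies, and_true] at h3 ⊢
      simp only [Fin.val_one, one_mul]
      exact ⟨by have := i2 h3.1; omega, fun h => by have := i3 h; omega⟩

theorem tribGreedy_tribVal (w : List (Fin 2)) (h3 : ¬ [1, 1, 1] <:+: w) :
    tribGreedy w.length (tribVal w) = w := by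
  induction w with
  | nil => rfl
  | cons a w ih =>
    rw [List.infix_cons_iff, not_or] at h3
    have i1 := (tribVal_lt_one w h3.2).1
    have ih := ih h3.2
    simp only [List.length_cons, tribVal, tribGreedy]
    obtain rfl | rfl : a = 0 ∨ a = 1 := by omega
    · rw [if_neg (by simpa using i1)]; simpa using ih
    · rw [if_pos (by simp)]; simpa using ih

theorem dropWhile_tribGreedy_add (k d n : ℕ) (h : n < tribNum (k + 2)) :
    (tribGreedy (k + d) n).dropWhile (· == 0) = (tribGreedy k n).dropWhile (· == 0) := by
  induction d with
  | zero => rfl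
  | succ d ih =>
    have hmono : tribNum (k + 2) ≤ tribNum (k + d + 2) := by
      have : Monotone fun j => tribNum (j + 2) := monotone_nat_of_le_succ fun j => by
        change tribNum (j + 2) ≤ tribNum (j + 2) + tribNum (j + 1) + tribNum j
        omega
      exact this (Nat.le_add_right k d)
    rw [← Nat.add_assoc, tribGreedy, if_neg (by omega)]
    simpa using ih

/-- `(n)_T` is the only canonical binary word of value `n`. -/
theorem tribRep_eq_iff (n : ℕ) (w : List (Fin 2)) :
    tribRep n = w ↔ IsTribCanonical w ∧ tribVal w = n := by
  constructor
  · rintro rfl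
    exact ⟨isTribCanonical_tribRep n, tribVal_tribRep n⟩
  · rintro ⟨⟨h0, h3⟩, rfl⟩
    have hlt := (tribVal_lt_one w h3).1
    have hle : w.length ≤ tribVal w := by
      cases w with
      | nil => simp
      | cons a w =>
        obtain rfl | rfl : a = 0 ∨ a = 1 := by omega
        · simp at h0
        · have := lt_tribNum_add_two w.length
          simp only [tribVal, List.length_cons, Fin.val_one, one_mul]; omega
    obtain ⟨d, hd⟩ := Nat.exists_eq_add_of_le hle
    have := dropWhile_tribGreedy_add w.length d (tribVal w) hlt
    rw [← hd, tribGreedy_tribVal w h3] at this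
    rw [tribRep, this]
    cases w with
    | nil => rfl
    | cons a w =>
      rw [List.dropWhile_cons, if_neg]
      intro ha
      apply h0
      simpa using ha

/-! ### The automaton -/

/-- The automaton for the lengths of unbordered factors. The row of index `q` of the table lists
the successors of the state `q` under the digits `0` and `1`; state `7` is the dead state. -/
def tribUnborderedDFA : DFA (Fin 2) (Fin 25) where
  step := ![
    ![0, 1],
    ![2, 3],
    ![4, 5],
    ![6, 7],
    ![8, 9],
    ![10, 3],
    ![11, 12],
    ![7, 7],
    ![8, 7],
    ![13, 3],
    ![14, 15],
    ![8, 16],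
    ![17, 3],
    ![18, 5],
    ![8, 19],
    ![8, 20],
    ![21, 8],
    ![22, 15],
    ![7, 9],
    ![23, 3],
    ![21, 7],
    ![24, 12],
    ![7, 19],
    ![22, 15],
    ![7, 16]]
  start := 0
  accept := {0, 1, 2, 3, 4, 5, 6, 8, 10, 11, 12, 14, 15, 17}

/-! Write `φ` for the morphism and `M` for its incidence matrix. An unbordered word of length
greater than 1 has distinct end letters. Since factors of the Tribonacci word are closed under
reversal, its first letter may be taken smaller than its last. If it begins with `0`, it ends with a
nonzero letter and is `φ u` for a shorter unbordered factor `u`. If it runs from `1` to `2`, it is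
preceded by `0`, and with that `0` it is `φ u` for a shorter unbordered factor `u` running from `0`
to `1`. Conversely, `φ` keeps an unbordered word unbordered if its last letter is not `2`, and so
does deleting the initial `0` of the image when the next letter is nonzero. Hence the Parikh vectors
of unbordered factors, apart from that of the word `2`, are those generated from the vectors of `0`
and `1` by maps `p ↦ M p - (e, 0, 0)` with `e` in `{0, 1}`, along a graph on pairs of end letters
(`UnborderedVec`).

Reading a digit `a` acts on vectors by `v ↦ M v + (a, 0, 0)`, and the coordinate sum of the
resulting vector is the value of the word (`vecSum_digitVec`). Both processes are driven by the same
matrix, so the offset between the vector of a binary word and a Parikh vector evolves by `d ↦ M d +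
(a + e, 0, 0)`, whatever the vectors themselves are. Two finite tables of small offsets therefore
prove the two directions: `stateOffsets` follows a binary word and produces unbordered factors,
while `offsetFamily` follows an unbordered factor and produces binary words. An offset of coordinate
sum zero turns equality of vectors up to offset into equality of length and value. -/

/-! ### The morphism on words -/

/-- The morphism `0 ↦ 01`, `1 ↦ 02`, `2 ↦ 0` on words. -/
def tribSubst (x : List (Fin 3)) : List (Fin 3) := x.flatMap tribMorphism

@[simp] theorem tribSubst_nil : tribSubst [] = [] := rfl

@[simp] theorem tribSubst_append (x y : List (Fin 3)) :
    tribSubst (x ++ y) = tribSubst x ++ tribSubst y := List.flatMap_append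

theorem tribMorphism_cases (c : Fin 3) : c = 2 ∧ tribMorphism c = [0] ∨
    c ≠ 2 ∧ c + 1 ≠ 0 ∧ tribMorphism c = [0, c + 1] := by
  fin_cases c <;> decide

theorem tribSubst_cons (c : Fin 3) (x : List (Fin 3)) :
    tribSubst (c :: x) = tribMorphism c ++ tribSubst x := rfl

theorem exists_tribSubst_eq_cons {x : List (Fin 3)} (h : x ≠ []) :
    ∃ y, tribSubst x = 0 :: y := by
  cases x with
  | nil => exact absurd rfl h
  | cons c x =>
    rw [tribSubst_cons]
    rcases tribMorphism_cases c with ⟨-, h⟩ | ⟨-, -, h⟩ <;> rw [h] <;> exact ⟨_, rfl⟩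

theorem tribSubst_eq_nil {x : List (Fin 3)} : tribSubst x = [] ↔ x = [] := by
  refine ⟨fun h => ?_, by rintro rfl; rfl⟩
  by_contra hx
  obtain ⟨y, hy⟩ := exists_tribSubst_eq_cons hx
  simp [hy] at h

theorem head_of_tribSubst_eq_cons {x y : List (Fin 3)} {c : Fin 3} (h : tribSubst x = c :: y) :
    c = 0 := by
  obtain ⟨z, hz⟩ := exists_tribSubst_eq_cons (x := x) (by rintro rfl; simp at h)
  rw [hz] at h
  exact (List.cons.inj h).1.symm

/-- The only `0` in a letter image is its first letter, so whatever follows the first `0` determines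
the first preimage letter. -/
theorem tribSubst_injective : Function.Injective tribSubst := by
  intro x
  induction x with
  | nil => intro y h; exact (tribSubst_eq_nil.1 h.symm).symm
  | cons c x ih =>
    intro y h
    cases y with
    | nil => exact absurd (tribSubst_eq_nil.1 h) (by simp)
    | cons d y =>
      simp only [tribSubst_cons] at h
      rcases tribMorphism_cases c with ⟨hc, e⟩ | ⟨-, hc, e⟩ <;>
        rcases tribMorphism_cases d with ⟨hd, f⟩ | ⟨-, hd, f⟩ <;>
        simp only [e, f, List.cons_append, List.nil_append, List.cons.injEq, true_and] at h
      · rw [hc, hd, ih h]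
      · exact absurd (head_of_tribSubst_eq_cons h) hd
      · exact absurd (head_of_tribSubst_eq_cons h.symm) hc
      · rw [add_right_cancel h.1, ih h.2]

/-- An image word can be cut before any letter `0`. -/
theorem tribSubst_split_before_zero {z a b : List (Fin 3)} (h : tribSubst z = a ++ 0 :: b) :
    ∃ z₁ z₂, z = z₁ ++ z₂ ∧ tribSubst z₁ = a ∧ tribSubst z₂ = 0 :: b := by
  induction z generalizing a with
  | nil => simp at h
  | cons c z ih =>
    cases a with
    | nil => exact ⟨[], c :: z, rfl, rfl, h⟩
    | cons d a =>
      rw [tribSubst_cons] at h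
      rcases tribMorphism_cases c with ⟨-, e⟩ | ⟨-, hc, e⟩
      · simp only [e, List.cons_append, List.nil_append, List.cons.injEq] at h
        obtain ⟨z₁, z₂, rfl, h₁, h₂⟩ := ih h.2
        exact ⟨c :: z₁, z₂, rfl, by rw [tribSubst_cons, e, h₁, ← h.1]; rfl, h₂⟩
      · cases a with
        | nil => simp [e, hc] at h
        | cons d' a =>
          simp only [e, List.cons_append, List.nil_append, List.cons.injEq] at h
          obtain ⟨z₁, z₂, rfl, h₁, h₂⟩ := ih h.2.2
          exact ⟨c :: z₁, z₂, rfl, by rw [tribSubst_cons, e, h₁, ← h.1, ← h.2.1]; rfl, h₂⟩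

/-- Two consecutive letters of an image word are not both nonzero. -/
theorem eq_zero_or_of_tribSubst_eq {z a b : List (Fin 3)} {c d : Fin 3}
    (h : tribSubst z = a ++ c :: d :: b) : c = 0 ∨ d = 0 := by
  induction z generalizing a with
  | nil => simp at h
  | cons f z ih =>
    rw [tribSubst_cons] at h
    rcases tribMorphism_cases f with ⟨-, e⟩ | ⟨-, -, e⟩ <;> rw [e] at h
    · rcases a with _ | ⟨g, a⟩
      · simp only [List.cons_append, List.nil_append, List.cons.injEq] at h
        exact Or.inl h.1.symm
      · simp only [List.cons_append, List.nil_append, List.cons.injEq] at h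
        exact ih h.2
    · rcases a with _ | ⟨g, _ | ⟨g', a⟩⟩ <;>
        simp only [List.cons_append, List.nil_append, List.cons.injEq] at h
      · exact Or.inl h.1.symm
      · exact Or.inr (head_of_tribSubst_eq_cons h.2.2)
      · exact ih h.2.2

/-- An image word can be cut after any nonzero letter. -/
theorem tribSubst_split_after_ne_zero {z a b : List (Fin 3)} {c : Fin 3} (hc : c ≠ 0)
    (h : tribSubst z = (a ++ [c]) ++ b) :
    ∃ z₁ z₂, z = z₁ ++ z₂ ∧ tribSubst z₁ = a ++ [c] ∧ tribSubst z₂ = b := by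
  cases b with
  | nil => exact ⟨z, [], by simp, by simpa using h, rfl⟩
  | cons d b =>
    have hd : d = 0 := (eq_zero_or_of_tribSubst_eq (a := a) (b := b) (c := c) (d := d)
      (by simpa using h)).resolve_left hc
    subst hd
    exact tribSubst_split_before_zero h

theorem getLast?_tribSubst {x : List (Fin 3)} {b : Fin 3} (hx : x.getLast? = some b)
    (hb : b ≠ 2) : (tribSubst x).getLast? = some (b + 1) := by
  obtain ⟨y, rfl⟩ := List.getLast?_eq_some_iff.1 hx
  rcases tribMorphism_cases b with ⟨h, -⟩ | ⟨-, -, h⟩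
  · exact absurd h hb
  · simp [tribSubst_cons, h]

theorem getLast?_of_tribSubst {x : List (Fin 3)} {c : Fin 3}
    (h : (tribSubst x).getLast? = some c) (hc : c ≠ 0) :
    ∃ b, x.getLast? = some b ∧ b ≠ 2 ∧ c = b + 1 := by
  rcases List.eq_nil_or_concat x with rfl | ⟨y, b, rfl⟩
  · simp at h
  · refine ⟨b, by simp, ?_⟩
    rcases tribMorphism_cases b with ⟨-, e⟩ | ⟨hb, -, e⟩
    · simp [tribSubst_cons, e] at h
      exact absurd h.symm hc
    · simp [tribSubst_cons, e] at h
      exact ⟨hb, h.symm⟩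

/-! ### Unbordered words and the morphism -/

theorem IsBorder.reverse {α : Type*} {x y : List α} (h : IsBorder y x) :
    IsBorder y.reverse x.reverse :=
  ⟨by simpa using h.1, by simpa using h.2.1, List.reverse_prefix.2 h.2.2.2,
    List.reverse_suffix.2 h.2.2.1⟩

theorem IsUnbordered.reverse {α : Type*} {x : List α} (h : IsUnbordered x) :
    IsUnbordered x.reverse :=
  fun ⟨y, hy⟩ => h ⟨y.reverse, by simpa using hy.reverse⟩

theorem isUnbordered_singleton {α : Type*} (a : α) : IsUnbordered [a] := by
  rintro ⟨y, h0, h1, h2, -⟩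
  rcases y with _ | ⟨b, y⟩
  · exact h0 rfl
  · rw [List.cons_prefix_cons] at h2
    apply h1
    rw [h2.1, List.prefix_nil.1 h2.2]

/-- An unbordered word with the same letter at both ends has length one. -/
theorem IsUnbordered.eq_singleton {α : Type*} {x : List α} {a : α} (h : IsUnbordered x)
    (h₁ : x.head? = some a) (h₂ : x.getLast? = some a) : x = [a] := by
  by_contra hx
  obtain ⟨y, rfl⟩ := List.getLast?_eq_some_iff.1 h₂
  obtain ⟨z, hz⟩ := List.head?_eq_some_iff.1 h₁
  exact h ⟨[a], by simp, fun h => hx h.symm, ⟨z, hz.symm⟩, ⟨y, rfl⟩⟩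

theorem isBorder_tribSubst {u v : List (Fin 3)} (h : IsBorder v u) :
    IsBorder (tribSubst v) (tribSubst u) := by
  obtain ⟨h0, h1, ⟨s, hs⟩, ⟨t, ht⟩⟩ := h
  exact ⟨fun h => h0 (tribSubst_eq_nil.1 h), fun h => h1 (tribSubst_injective h),
    ⟨_, by rw [← tribSubst_append, hs]⟩, ⟨_, by rw [← tribSubst_append, ht]⟩⟩

theorem IsUnbordered.of_tribSubst {u : List (Fin 3)} (h : IsUnbordered (tribSubst u)) :
    IsUnbordered u :=
  fun ⟨_, hv⟩ => h ⟨_, isBorder_tribSubst hv⟩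

/-- A border of the image begins with `0` and ends with `b + 1 ≠ 0`. Both of its occurrences can
thus be cut out along letter images, and by injectivity their preimages are one word, a border of
`u`. -/
theorem isUnbordered_tribSubst {u : List (Fin 3)} {b : Fin 3} (h : IsUnbordered u)
    (hu : u.getLast? = some b) (hb : b ≠ 2) : IsUnbordered (tribSubst u) := by
  rintro ⟨y, h0, h1, ⟨t, ht⟩, ⟨s, hs⟩⟩
  have hl := getLast?_tribSubst hu hb
  have hb' : b + 1 ≠ 0 := by
    rcases tribMorphism_cases b with ⟨h, -⟩ | ⟨-, h, -⟩
    · exact absurd h hb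
    · exact h
  obtain ⟨d, y', rfl⟩ := List.exists_cons_of_ne_nil h0
  obtain rfl : d = 0 := head_of_tribSubst_eq_cons ht.symm
  obtain ⟨u₁, v, hu1, -, hv⟩ := tribSubst_split_before_zero hs.symm
  obtain ⟨y'', hy''⟩ : ∃ y'', 0 :: y' = y'' ++ [b + 1] := by
    apply List.getLast?_eq_some_iff.1
    rw [← hs, List.getLast?_append] at hl
    rw [← hl, List.getLast?_eq_getLast_of_ne_nil h0]
    rfl
  rw [hy''] at ht
  obtain ⟨v', u₂, hu2, hv', -⟩ := tribSubst_split_after_ne_zero hb' ht.symm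
  have hvv : v = v' := tribSubst_injective (by rw [hv, hv', hy''])
  refine h ⟨v, ?_, ?_, ⟨u₂, by rw [hvv, hu2]⟩, ⟨u₁, hu1.symm⟩⟩
  · rintro rfl; simp at hv
  · rintro rfl; exact h1 hv.symm

/-- A border of `w` begins with `c ≠ 0`, so its occurrence as a suffix is preceded by `0`.
Prepending this `0` gives a border of `0 :: w`. -/
theorem IsUnbordered.of_cons_zero {u w : List (Fin 3)} (hw : tribSubst u = 0 :: w)
    {c : Fin 3} (hc : w.head? = some c) (hc0 : c ≠ 0) (h : IsUnbordered (0 :: w)) :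
    IsUnbordered w := by
  rintro ⟨y, h0, h1, hp, ⟨s, rfl⟩⟩
  obtain ⟨d, y, rfl⟩ := List.exists_cons_of_ne_nil h0
  have hd : d = c := by
    obtain ⟨t, ht⟩ := hp
    rw [← ht] at hc
    simpa using hc
  rcases List.eq_nil_or_concat s with rfl | ⟨s, e, rfl⟩
  · exact h1 rfl
  · have he : e = 0 := (eq_zero_or_of_tribSubst_eq (a := 0 :: s) (b := y) (c := e) (d := d)
      (by simpa using hw)).resolve_right (hd ▸ hc0)
    refine h ⟨0 :: d :: y, by simp, by simpa using h1, ?_, ⟨0 :: s, by simp [he]⟩⟩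
    simpa [List.cons_prefix_cons] using hp

/-- A border of `u` begins with `0`, so its image begins with `01`. Without the leading `0` that
image is still nonempty and is a border of `w`. -/
theorem IsUnbordered.of_tribSubst_eq_cons {u w : List (Fin 3)} (hw : tribSubst u = 0 :: w)
    (hu : u.head? = some 0) (h : IsUnbordered w) : IsUnbordered u := by
  rintro ⟨v, hv⟩
  obtain ⟨v0, v1, ⟨t, ht⟩, -⟩ := id hv
  obtain ⟨d, v, rfl⟩ := List.exists_cons_of_ne_nil v0
  have hd : d = 0 := by rw [← ht] at hu; simpa using hu
  subst hd
  have hb := isBorder_tribSubst hv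
  rw [hw] at hb
  have e : tribSubst (0 :: v) = 0 :: 1 :: tribSubst v := rfl
  rw [e] at hb
  refine h ⟨1 :: tribSubst v, by simp, by simpa using hb.2.1, ?_, ?_⟩
  · simpa [List.cons_prefix_cons] using hb.2.2.1
  · have := (List.suffix_cons_iff.1 hb.2.2.2).resolve_left hb.2.1
    exact (List.suffix_cons 0 _).trans this

/-! ### Factors of the Tribonacci word -/

theorem tribFactor_add (i m n : ℕ) :
    tribFactor i (m + n) = tribFactor i m ++ tribFactor (i + m) n := by
  simp [tribFactor, List.range_add, Nat.add_assoc]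

@[simp] theorem length_tribFactor (i n : ℕ) : (tribFactor i n).length = n := by
  simp [tribFactor]

theorem isTribFactor_iff_infix {x : List (Fin 3)} :
    IsTribFactor x ↔ ∃ k, x <:+: tribIter k := by
  constructor
  · rintro ⟨i, hx⟩
    refine ⟨i + x.length, ?_⟩
    obtain ⟨d, hd⟩ := Nat.exists_eq_add_of_lt (lt_length_tribIter (i + x.length))
    rw [tribIter_eq_tribFactor, hd, Nat.add_assoc (i + x.length), tribFactor_add, tribFactor_add,
      Nat.zero_add, ← hx]
    exact ⟨_, _, rfl⟩
  · rintro ⟨k, s, t, h⟩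
    have h2 := tribIter_eq_tribFactor k
    rw [← h, List.length_append, List.length_append, tribFactor_add, tribFactor_add] at h2
    have h3 := (List.append_inj h2 (by simp)).1
    exact ⟨_, (List.append_inj h3 (by simp)).2⟩

theorem IsTribFactor.of_infix {x y : List (Fin 3)} (hy : IsTribFactor y) (h : x <:+: y) :
    IsTribFactor x := by
  obtain ⟨k, hk⟩ := isTribFactor_iff_infix.1 hy
  exact isTribFactor_iff_infix.2 ⟨k, h.trans hk⟩

theorem tribIter_succ (k : ℕ) : tribIter (k + 1) = tribSubst (tribIter k) := rfl

theorem isTribFactor_tribSubst {x : List (Fin 3)} (h : IsTribFactor x) :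
    IsTribFactor (tribSubst x) := by
  obtain ⟨k, s, t, hk⟩ := isTribFactor_iff_infix.1 h
  exact isTribFactor_iff_infix.2
    ⟨k + 1, tribSubst s, tribSubst t, by rw [tribIter_succ, ← hk]; simp⟩

theorem IsTribFactor.exists_append_singleton {x : List (Fin 3)} (h : IsTribFactor x) :
    ∃ c, IsTribFactor (x ++ [c]) := by
  obtain ⟨i, hx⟩ := h
  refine ⟨tribWord (i + x.length), i, ?_⟩
  rw [List.length_append, tribFactor_add, ← hx]
  simp [tribFactor]

theorem IsTribFactor.exists_infix_tribSubst {w : List (Fin 3)} (h : IsTribFactor w) :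
    ∃ z, IsTribFactor z ∧ w <:+: tribSubst z := by
  obtain ⟨k, hk⟩ := isTribFactor_iff_infix.1 h
  exact ⟨tribIter k, isTribFactor_iff_infix.2 ⟨k, List.infix_rfl⟩,
    tribIter_succ k ▸ hk.trans (tribIter_prefix_succ k).isInfix⟩

/-- The morphism and its mirror image are conjugate by `0`, which need only be checked on letters.
-/
theorem cons_zero_reverse_tribSubst (x : List (Fin 3)) :
    0 :: (tribSubst x).reverse = tribSubst x.reverse ++ [0] := by
  induction x with
  | nil => rfl
  | cons c x ih =>
    rw [tribSubst_cons, List.reverse_append, ← List.cons_append, ih, List.reverse_cons,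
      tribSubst_append, tribSubst_cons c []]
    rcases tribMorphism_cases c with ⟨-, e⟩ | ⟨-, -, e⟩ <;> simp [e]

/-- The set of factors of the Tribonacci word is closed under reversal. -/
theorem IsTribFactor.reverse {x : List (Fin 3)} (h : IsTribFactor x) : IsTribFactor x.reverse := by
  have key : ∀ k, IsTribFactor (tribIter k).reverse := by
    intro k
    induction k with
    | zero => exact isTribFactor_iff_infix.2 ⟨0, List.infix_rfl⟩
    | succ k ih =>
      -- The image of an extra letter `c` supplies the final `0` of the conjugation identity.
      obtain ⟨c, hc⟩ := ih.exists_append_singleton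
      refine (isTribFactor_tribSubst hc).of_infix ?_
      obtain ⟨y, hy⟩ := exists_tribSubst_eq_cons (x := [c]) (by simp)
      refine ⟨[0], y, ?_⟩
      rw [tribSubst_append, hy, tribIter_succ, List.singleton_append,
        cons_zero_reverse_tribSubst]
      simp
  obtain ⟨k, hk⟩ := isTribFactor_iff_infix.1 h
  exact (key k).of_infix (List.reverse_infix.2 hk)

theorem IsTribFactor.exists_cons {x : List (Fin 3)} (h : IsTribFactor x) :
    ∃ c, IsTribFactor (c :: x) := by
  obtain ⟨c, hc⟩ := h.reverse.exists_append_singleton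
  exact ⟨c, by simpa using hc.reverse⟩

/-- A factor that starts with `0` and ends with a nonzero letter has a preimage that is a factor. -/
theorem IsTribFactor.exists_eq_tribSubst {w : List (Fin 3)} {b : Fin 3} (h : IsTribFactor w)
    (h₀ : w.head? = some 0) (h₁ : w.getLast? = some b) (hb : b ≠ 0) :
    ∃ u, IsTribFactor u ∧ tribSubst u = w := by
  obtain ⟨z, hz, s, t, hw⟩ := h.exists_infix_tribSubst
  obtain ⟨w', rfl⟩ := List.head?_eq_some_iff.1 h₀
  obtain ⟨z₁, z₂, rfl, -, h2⟩ :=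
    tribSubst_split_before_zero (z := z) (a := s) (b := w' ++ t) (by rw [← hw]; simp)
  obtain ⟨y, hy⟩ := List.getLast?_eq_some_iff.1 h₁
  obtain ⟨u, v, rfl, hu, -⟩ := tribSubst_split_after_ne_zero (z := z₂) (a := y) (b := t) hb
    (by rw [h2, ← hy]; rfl)
  exact ⟨u, hz.of_infix ⟨z₁, v, by simp⟩, by rw [hu, hy]⟩

/-- Two consecutive letters of the Tribonacci word are not both nonzero. -/
theorem IsTribFactor.eq_zero_or {c d : Fin 3} {w : List (Fin 3)} (h : IsTribFactor (c :: d :: w)) :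
    c = 0 ∨ d = 0 := by
  obtain ⟨z, -, s, t, hw⟩ := h.exists_infix_tribSubst
  exact eq_zero_or_of_tribSubst_eq (z := z) (a := s) (b := w ++ t) (by rw [← hw]; simp)

/-! ### Parikh vectors -/

/-- The numbers of occurrences of the letters `0`, `1`, `2`. -/
def parikh (x : List (Fin 3)) : ℤ × ℤ × ℤ := (x.count 0, x.count 1, x.count 2)

/-- The incidence matrix of the morphism. -/
def tribMat (v : ℤ × ℤ × ℤ) : ℤ × ℤ × ℤ := (v.1 + v.2.1 + v.2.2, v.1, v.2.1)

/-- The sum of the coordinates. -/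
def vecSum (v : ℤ × ℤ × ℤ) : ℤ := v.1 + v.2.1 + v.2.2

theorem tribMat_add (u v : ℤ × ℤ × ℤ) : tribMat (u + v) = tribMat u + tribMat v := by
  ext <;> simp [tribMat]; ring

theorem tribMat_sub (u v : ℤ × ℤ × ℤ) : tribMat (u - v) = tribMat u - tribMat v := by
  ext <;> simp [tribMat]; ring

theorem parikh_append (x y : List (Fin 3)) : parikh (x ++ y) = parikh x + parikh y := by
  simp [parikh]

theorem parikh_eq_sub (x : List (Fin 3)) : parikh x = parikh (0 :: x) - (1, 0, 0) := by
  simp [parikh]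

theorem parikh_reverse (x : List (Fin 3)) : parikh x.reverse = parikh x := by
  simp [parikh]

theorem parikh_tribSubst (x : List (Fin 3)) : parikh (tribSubst x) = tribMat (parikh x) := by
  induction x with
  | nil => rfl
  | cons c x ih =>
    rw [tribSubst_cons, parikh_append, ih, ← List.singleton_append, parikh_append, tribMat_add]
    congr 1
    fin_cases c <;> rfl

theorem vecSum_parikh (x : List (Fin 3)) : vecSum (parikh x) = x.length := by
  induction x with
  | nil => rfl
  | cons c x ih =>
    rw [← List.singleton_append, parikh_append, List.length_append, Nat.cast_add, ← ih]
    have : vecSum (parikh [c]) = 1 := by fin_cases c <;> rfl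
    simp only [vecSum, Prod.fst_add, Prod.snd_add, List.length_singleton, Nat.cast_one] at *
    linarith

/-! ### Parikh vectors of unbordered factors -/

/-- `(s, t, e)` is listed if the Parikh vector `p` of an unbordered factor whose first and last
letters are those of `s` gives the vector `M p - (e, 0, 0)` of one with the letters of `t`. -/
def unborderedEdges : List ((Fin 3 × Fin 3) × (Fin 3 × Fin 3) × ℤ) :=
  [((0, 0), (0, 1), 0), ((1, 1), (0, 2), 0), ((0, 1), (0, 1), 0), ((0, 1), (0, 2), 0),
    ((0, 1), (1, 2), 1), ((0, 2), (0, 1), 0), ((1, 2), (0, 2), 0)]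

/-- The Parikh vectors of the unbordered factors, indexed by the first and last letters (in
increasing order). -/
inductive UnborderedVec : Fin 3 × Fin 3 → ℤ × ℤ × ℤ → Prop
  | zero : UnborderedVec (0, 0) (1, 0, 0)
  | one : UnborderedVec (1, 1) (0, 1, 0)
  | step {s t : Fin 3 × Fin 3} {e : ℤ} {p : ℤ × ℤ × ℤ} (h : (s, t, e) ∈ unborderedEdges)
      (hp : UnborderedVec s p) : UnborderedVec t (tribMat p - (e, 0, 0))

/-- `p` is the Parikh vector of an unbordered factor with first letter `a` and last letter `b`. -/
def HasUnborderedFactor (a b : Fin 3) (p : ℤ × ℤ × ℤ) : Prop :=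
  ∃ x, IsTribFactor x ∧ IsUnbordered x ∧ x.head? = some a ∧ x.getLast? = some b ∧ parikh x = p

theorem HasUnborderedFactor.symm {a b : Fin 3} {p : ℤ × ℤ × ℤ} (h : HasUnborderedFactor a b p) :
    HasUnborderedFactor b a p := by
  obtain ⟨x, h1, h2, h3, h4, h5⟩ := h
  exact ⟨x.reverse, h1.reverse, h2.reverse, by simpa using h4, by simpa using h3,
    (parikh_reverse x).trans h5⟩

theorem head?_tribSubst {x : List (Fin 3)} {a : Fin 3} (h : x.head? = some a) :
    (tribSubst x).head? = some 0 := by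
  obtain ⟨y, hy⟩ := exists_tribSubst_eq_cons (x := x) (by rintro rfl; simp at h)
  rw [hy]; rfl

theorem HasUnborderedFactor.map {a b : Fin 3} {p : ℤ × ℤ × ℤ} (h : HasUnborderedFactor a b p)
    (hb : b ≠ 2) : HasUnborderedFactor 0 (b + 1) (tribMat p) := by
  obtain ⟨x, h1, h2, h3, h4, h5⟩ := h
  exact ⟨tribSubst x, isTribFactor_tribSubst h1, isUnbordered_tribSubst h2 h4 hb,
    head?_tribSubst h3, getLast?_tribSubst h4 hb, by rw [parikh_tribSubst, h5]⟩

theorem HasUnborderedFactor.tail {p : ℤ × ℤ × ℤ} (h : HasUnborderedFactor 0 1 p) :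
    HasUnborderedFactor 1 2 (tribMat p - (1, 0, 0)) := by
  obtain ⟨x, h1, h2, h3, h4, h5⟩ := h
  obtain ⟨y, rfl⟩ := List.head?_eq_some_iff.1 h3
  have e : tribSubst (0 :: y) = 0 :: 1 :: tribSubst y := rfl
  have hl := getLast?_tribSubst h4 (by decide)
  have hu := isUnbordered_tribSubst h2 h4 (by decide)
  rw [e] at hu hl
  refine ⟨1 :: tribSubst y, (isTribFactor_tribSubst h1).of_infix ?_, hu.of_cons_zero e rfl
    (by decide), rfl, by simpa using hl, ?_⟩
  · rw [e]; exact (List.suffix_cons _ _).isInfix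
  · rw [← h5, ← parikh_tribSubst, e, parikh_eq_sub]

/-- Each edge is realized by applying the morphism to the factor or to its reversal; the edge with
`e = 1` also deletes the leading `0`. -/
theorem UnborderedVec.hasUnborderedFactor {g : Fin 3 × Fin 3} {p : ℤ × ℤ × ℤ}
    (h : UnborderedVec g p) : HasUnborderedFactor g.1 g.2 p := by
  induction h with
  | zero => exact ⟨[0], ⟨0, rfl⟩, isUnbordered_singleton _, rfl, rfl, rfl⟩
  | one => exact ⟨[1], ⟨1, rfl⟩, isUnbordered_singleton _, rfl, rfl, rfl⟩
  | @step s t e p h hp ih =>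
    have z : ∀ v : ℤ × ℤ × ℤ, v - (0, 0, 0) = v := sub_zero
    simp only [unborderedEdges, List.mem_cons, Prod.mk.injEq, List.not_mem_nil, or_false] at h
    rcases h with ⟨rfl, rfl, rfl⟩ | ⟨rfl, rfl, rfl⟩ | ⟨rfl, rfl, rfl⟩ | ⟨rfl, rfl, rfl⟩ |
      ⟨rfl, rfl, rfl⟩ | ⟨rfl, rfl, rfl⟩ | ⟨rfl, rfl, rfl⟩
    · rw [z]; exact ih.map (by decide)
    · rw [z]; exact ih.map (by decide)
    · rw [z]; exact ih.symm.map (by decide)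
    · rw [z]; exact ih.map (by decide)
    · exact ih.tail
    · rw [z]; exact ih.symm.map (by decide)
    · rw [z]; exact ih.symm.map (by decide)

theorem length_add_count_tribSubst (x : List (Fin 3)) :
    (tribSubst x).length = x.length + x.count 0 + x.count 1 := by
  have h1 := vecSum_parikh (tribSubst x)
  have h2 := vecSum_parikh x
  rw [parikh_tribSubst] at h1
  simp only [vecSum, tribMat, parikh] at h1 h2
  omega

theorem unborderedEdges_of_le : ∀ c b : Fin 3, b ≠ 2 → c ≤ b →
    ((c, b), (0, b + 1), 0) ∈ unborderedEdges := by
  decide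

theorem unborderedEdges_of_gt : ∀ c b : Fin 3, b < c →
    ((b, c), (0, b + 1), 0) ∈ unborderedEdges := by
  decide

/-- Desubstitution, by induction on the length. The condition `a ≠ 2` only excludes the word `2`,
which has no place in the graph. -/
theorem unborderedVec_of_isUnbordered {x : List (Fin 3)} {a b : Fin 3} (hx : IsTribFactor x)
    (hu : IsUnbordered x) (ha : x.head? = some a) (hb : x.getLast? = some b) (hab : a ≤ b)
    (ha2 : a ≠ 2) : UnborderedVec (a, b) (parikh x) := by
  induction hn : x.length using Nat.strong_induction_on generalizing x a b with
  | _ n ih =>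
  subst hn
  have step0 : ∀ (u : List (Fin 3)) (c d : Fin 3), IsTribFactor u → IsUnbordered u →
      u.length < x.length → u.head? = some c → u.getLast? = some d → d ≠ 2 →
      UnborderedVec (0, d + 1) (parikh (tribSubst u)) := by
    intro u c d hu1 hu2 hlt hc hd hd2
    rw [parikh_tribSubst, ← sub_zero (tribMat _)]
    rcases le_or_gt c d with hcd | hcd
    · refine .step (unborderedEdges_of_le c d hd2 hcd) (ih _ hlt hu1 hu2 hc hd hcd ?_ rfl)
      rintro rfl
      exact hd2 (le_antisymm (Fin.le_last d) hcd)
    · rw [← parikh_reverse u]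
      exact .step (unborderedEdges_of_gt c d hcd) (ih _ (by simpa using hlt) hu1.reverse
        hu2.reverse (by simpa using hd) (by simpa using hc) hcd.le hd2 (by simp))
  -- Letters `0` and `1` have images of length 2, so one of them makes the preimage strictly
  -- shorter.
  have count_pos : ∀ (u : List (Fin 3)) (d : Fin 3), u.getLast? = some d → d ≠ 2 →
      0 < u.count 0 + u.count 1 := by
    intro u d hd hd2
    have hm := List.count_pos_iff.2 (List.mem_of_getLast? hd)
    fin_cases d
    · exact Nat.add_pos_left hm _
    · exact Nat.add_pos_right _ hm
    · exact absurd rfl hd2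
  rcases eq_or_ne a b with rfl | hne
  · rw [hu.eq_singleton ha hb]
    fin_cases a
    · exact .zero
    · exact .one
    · exact absurd rfl ha2
  rcases eq_or_ne a 0 with rfl | ha0
  · obtain ⟨u, hu1, rfl⟩ := hx.exists_eq_tribSubst ha hb hne.symm
    obtain ⟨d, hd, hd2, rfl⟩ := getLast?_of_tribSubst hb hne.symm
    have hlen := length_add_count_tribSubst u
    have := count_pos u d hd hd2
    obtain ⟨c, hc⟩ : ∃ c, u.head? = some c := by
      cases u with
      | nil => simp at hd
      | cons c u => exact ⟨c, rfl⟩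
    exact step0 u c d hu1 hu.of_tribSubst (by omega) hc hd hd2
  · obtain ⟨rfl, rfl⟩ : a = 1 ∧ b = 2 := by
      omega
    obtain ⟨c, hc⟩ := hx.exists_cons
    obtain ⟨w, rfl⟩ := List.head?_eq_some_iff.1 ha
    obtain rfl : c = 0 := hc.eq_zero_or.resolve_right (by decide)
    have hb' : (0 :: 1 :: w).getLast? = some 2 := by simpa using hb
    obtain ⟨u, hu1, hu2⟩ := hc.exists_eq_tribSubst rfl hb' (by decide)
    rw [← hu2] at hb'
    obtain ⟨d, hd, hd2, hd1⟩ := getLast?_of_tribSubst hb' (by decide)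
    obtain rfl : d = 1 := by
      have : ∀ d : Fin 3, 2 = d + 1 → d = 1 := by decide
      exact this d hd1
    -- Among images, only that of `0` can open with `01`.
    obtain ⟨v, rfl⟩ : ∃ v, u = 0 :: v := by
      cases u with
      | nil => simp at hd
      | cons f v =>
        refine ⟨v, ?_⟩
        rw [tribSubst_cons] at hu2
        rcases tribMorphism_cases f with ⟨-, e⟩ | ⟨-, -, e⟩ <;> rw [e] at hu2 <;>
          simp only [List.cons_append, List.nil_append, List.cons.injEq, true_and] at hu2
        · exact absurd (head_of_tribSubst_eq_cons hu2) (by decide)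
        · rw [add_right_cancel (hu2.1.trans (zero_add 1).symm)]
    have hlen := length_add_count_tribSubst (0 :: v)
    -- The preimage contains both a `0` and a `1`, so it remains shorter even after the prepended
    -- `0` is discounted.
    have h0 : 0 < (0 :: v).count 0 := by simp
    have h1 := List.count_pos_iff.2 (List.mem_of_getLast? hd)
    have hlt : (0 :: v).length < (1 :: w).length := by
      rw [hu2] at hlen
      simp only [List.length_cons] at hlen ⊢
      omega
    have key := ih _ hlt hu1 (hu.of_tribSubst_eq_cons hu2 rfl) rfl hd (by decide) (by decide) rfl
    have e : parikh (1 :: w) = tribMat (parikh (0 :: v)) - (1, 0, 0) := by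
      rw [← parikh_tribSubst, hu2, parikh_eq_sub]
    rw [e]
    exact .step (by decide) key

/-- The lengths of the nonempty unbordered factors are the lengths of the listed vectors. -/
theorem exists_isUnbordered_iff {n : ℕ} (hn : n ≠ 0) :
    (∃ x : List (Fin 3), IsTribFactor x ∧ x.length = n ∧ IsUnbordered x) ↔
      ∃ g p, UnborderedVec g p ∧ vecSum p = n := by
  constructor
  · rintro ⟨x, h1, rfl, h2⟩
    obtain ⟨a, ha⟩ : ∃ a, x.head? = some a := by
      cases x with
      | nil => simp at hn
      | cons a x => exact ⟨a, rfl⟩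
    obtain ⟨b, hb⟩ : ∃ b, x.getLast? = some b := by
      rcases List.eq_nil_or_concat x with rfl | ⟨y, b, rfl⟩
      · simp at hn
      · exact ⟨b, by simp⟩
    by_cases h22 : a = 2 ∧ b = 2
    · obtain ⟨rfl, rfl⟩ := h22
      rw [h2.eq_singleton ha hb]
      -- The vector of the word `2` is not generated, but its length 1 is also that of the word `0`.
      exact ⟨_, _, .zero, rfl⟩
    · rcases le_total a b with hab | hab
      · refine ⟨_, _, unborderedVec_of_isUnbordered h1 h2 ha hb hab ?_, vecSum_parikh x⟩
        rintro rfl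
        exact h22 ⟨rfl, le_antisymm (Fin.le_last b) hab⟩
      · refine ⟨_, _, unborderedVec_of_isUnbordered h1.reverse h2.reverse (by simpa using hb)
          (by simpa using ha) hab ?_, by rw [vecSum_parikh, List.length_reverse]⟩
        rintro rfl
        exact h22 ⟨le_antisymm (Fin.le_last a) hab, rfl⟩
  · rintro ⟨g, p, h, hp⟩
    obtain ⟨x, h1, h2, -, -, rfl⟩ := h.hasUnborderedFactor
    rw [vecSum_parikh] at hp
    exact ⟨x, h1, by exact_mod_cast hp, h2⟩

/-! ### Vectors of binary words -/

/-- One more digit `a` at the right of a binary word, on the level of vectors. -/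
def digitStep (v : ℤ × ℤ × ℤ) (a : Fin 2) : ℤ × ℤ × ℤ := tribMat v + ((a.val : ℤ), 0, 0)

/-- The vector `∑ aᵢ M ^ (n - i) (1, 0, 0)` of a binary word `a₁ ⋯ aₙ`. -/
def digitVec (w : List (Fin 2)) : ℤ × ℤ × ℤ := w.foldl digitStep 0

theorem digitVec_append_singleton (w : List (Fin 2)) (a : Fin 2) :
    digitVec (w ++ [a]) = tribMat (digitVec w) + ((a.val : ℤ), 0, 0) := by
  simp [digitVec, digitStep]

/-- The coefficients of the coordinates of `v` are the lengths of the iterated images of `0`, `1`,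
`2` after `w.length` steps. -/
theorem vecSum_foldl_digitStep (w : List (Fin 2)) (v : ℤ × ℤ × ℤ) :
    vecSum (w.foldl digitStep v) = v.1 * tribNum (w.length + 2) +
      v.2.1 * (tribNum (w.length + 1) + tribNum w.length) + v.2.2 * tribNum (w.length + 1) +
      tribVal w := by
  induction w generalizing v with
  | nil => simp [vecSum, tribVal, tribNum]
  | cons a w ih =>
    have e : tribNum (w.length + 1 + 2) =
      tribNum (w.length + 2) + tribNum (w.length + 1) + tribNum w.length := rfl
    rw [List.foldl_cons, ih, List.length_cons, e]
    simp only [digitStep, tribMat, tribVal, Prod.fst_add, Prod.snd_add, Nat.cast_add, Nat.cast_mul]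
    ring_nf

theorem vecSum_digitVec (w : List (Fin 2)) : vecSum (digitVec w) = tribVal w := by
  rw [digitVec, vecSum_foldl_digitStep]
  simp

theorem vecSum_add (u v : ℤ × ℤ × ℤ) : vecSum (u + v) = vecSum u + vecSum v := by
  simp [vecSum]; ring

theorem vecSum_sub (u v : ℤ × ℤ × ℤ) : vecSum (u - v) = vecSum u - vecSum v := by
  simp [vecSum]; ring

/-! ### Accepted words give unbordered factors -/

/-- For each state `q`, pairs `(d, g)` such that `digitVec w - d` is the Parikh vector of an
unbordered factor of type `g` whenever `w` leads to `q`. -/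
def stateOffsets : Fin 25 → List ((ℤ × ℤ × ℤ) × (Fin 3 × Fin 3)) := ![
    [((-1, 0, 0), (0, 0)), ((0, -1, 0), (1, 1))],
    [((0, -1, 0), (0, 1)), ((0, 0, -1), (0, 2)), ((0, 0, 0), (0, 0))],
    [((-1, 0, 0), (0, 1)), ((0, 0, -1), (1, 2)), ((0, 0, 0), (0, 1))],
    [((0, 0, -1), (0, 1)), ((1, 0, -1), (1, 2))],
    [((-1, 0, 0), (0, 2)), ((0, -1, 0), (1, 2)), ((0, 0, 0), (0, 1))],
    [((0, -1, 0), (0, 1)), ((0, 0, 0), (0, 2))],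
    [((-1, 0, 0), (0, 1)), ((0, 0, 0), (1, 2))],
    [],
    [((0, 0, 0), (0, 1))],
    [((0, -1, 0), (0, 1)), ((0, 0, -1), (0, 2))],
    [((-1, 0, -1), (0, 1)), ((0, 0, -1), (1, 2)), ((0, 0, 0), (0, 1))],
    [((0, -1, 0), (1, 2)), ((0, 0, 0), (0, 2))],
    [((0, -1, 0), (0, 1)), ((1, -1, 0), (1, 2))],
    [((-1, 0, 0), (0, 1)), ((0, 0, -1), (1, 2))],
    [((-1, 0, 0), (0, 2)), ((0, 0, 0), (0, 2))],
    [((0, -1, 0), (1, 2)), ((0, 0, 0), (0, 2))],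
    [((0, 0, -1), (0, 2))],
    [((-1, 0, -1), (0, 1)), ((0, 0, -1), (1, 2)), ((0, 1, -1), (0, 2))],
    [((-1, 0, 0), (0, 2)), ((0, -1, 0), (1, 2))],
    [((0, -1, 0), (0, 1))],
    [((0, 0, -1), (0, 2))],
    [((-1, 0, 0), (0, 1))],
    [((-1, 0, 0), (0, 2))],
    [((-1, 0, -1), (0, 1)), ((0, 0, -1), (1, 2))],
    [((0, -1, 0), (1, 2))]]

/-- Every offset after a digit is traced back along an edge to an offset before it, unless it comes
from state `0`, where the word read so far has vector zero and the generators can start afresh. -/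
theorem stateOffsets_step : ∀ (q : Fin 25) (a : Fin 2),
    ∀ y ∈ stateOffsets (tribUnborderedDFA.step q a),
      (∃ x ∈ stateOffsets q, ∃ e ∈ unborderedEdges, e.1 = x.2 ∧ e.2.1 = y.2 ∧
        y.1 = tribMat x.1 + ((a.val : ℤ), 0, 0) + (e.2.2, 0, 0)) ∨
      q = 0 ∧ (y.2 = (0, 0) ∧ ((a.val : ℤ), 0, 0) - y.1 = (1, 0, 0) ∨
        y.2 = (1, 1) ∧ ((a.val : ℤ), 0, 0) - y.1 = (0, 1, 0)) := by
  decide +kernel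

theorem step_eq_zero : ∀ (q : Fin 25) (a : Fin 2),
    tribUnborderedDFA.step q a = 0 → q = 0 ∧ a = 0 := by
  decide +kernel

theorem exists_stateOffsets_of_accept : ∀ q : Fin 25, q ∈ tribUnborderedDFA.accept → q ≠ 0 →
    ∃ y ∈ stateOffsets q, vecSum y.1 = 0 := by
  have : ∀ q : Fin 25, q ∈ ({0, 1, 2, 3, 4, 5, 6, 8, 10, 11, 12, 14, 15, 17} : Finset (Fin 25)) →
      q ≠ 0 → ∃ y ∈ stateOffsets q, vecSum y.1 = 0 := by
    decide +kernel
  intro q hq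
  exact this q (by simpa [tribUnborderedDFA] using hq)

theorem eval_eq_zero_and_unborderedVec (w : List (Fin 2)) :
    (tribUnborderedDFA.eval w = 0 → digitVec w = 0) ∧
      ∀ y ∈ stateOffsets (tribUnborderedDFA.eval w), UnborderedVec y.2 (digitVec w - y.1) := by
  induction w using List.reverseRecOn with
  | nil =>
    refine ⟨fun _ => rfl, fun y hy => ?_⟩
    obtain rfl | rfl : y = ((-1, 0, 0), (0, 0)) ∨ y = ((0, -1, 0), (1, 1)) := by
      change y ∈ [_, _] at hy
      simpa using hy
    · exact .zero
    · exact .one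
  | append_singleton w a ih =>
    rw [DFA.eval_append_singleton, digitVec_append_singleton]
    constructor
    · intro h
      obtain ⟨h0, rfl⟩ := step_eq_zero _ _ h
      rw [ih.1 h0]
      rfl
    · intro y hy
      rcases stateOffsets_step _ _ y hy with ⟨x, hx, ⟨s, t, e⟩, he, h1, h2, h3⟩ | ⟨h0, h⟩
      · dsimp only at h1 h2 h3
        subst h1 h2
        have := UnborderedVec.step he (ih.2 x hx)
        rw [tribMat_sub] at this
        rw [h3]
        convert this using 1
        abel
      · rw [ih.1 h0, show tribMat 0 = 0 from rfl, zero_add]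
        generalize ((a.val : ℤ), (0 : ℤ), (0 : ℤ)) - y.1 = v at h ⊢
        rcases h with ⟨h1, rfl⟩ | ⟨h1, rfl⟩ <;> rw [h1]
        · exact .zero
        · exact .one

theorem exists_unborderedVec_of_accepts {w : List (Fin 2)} (h : w ∈ tribUnborderedDFA.accepts)
    (h0 : tribVal w ≠ 0) : ∃ g p, UnborderedVec g p ∧ vecSum p = tribVal w := by
  obtain ⟨ih0, ih⟩ := eval_eq_zero_and_unborderedVec w
  have hq : tribUnborderedDFA.eval w ≠ 0 := by
    intro hq
    have := vecSum_digitVec w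
    rw [ih0 hq] at this
    exact h0 (by simpa [vecSum] using this.symm)
  obtain ⟨y, hy, hs⟩ := exists_stateOffsets_of_accept _ h hq
  exact ⟨_, _, ih y hy, by rw [vecSum_sub, vecSum_digitVec, hs, sub_zero]⟩

/-! ### Unbordered factors give accepted words -/

/-- Each Parikh vector `p` of an unbordered factor of type `g` has an entry `(g, Y)` such that for
all `(q, d)` in `Y` some binary word with vector `p + d` leads to the state `q`. -/
def offsetFamily : List ((Fin 3 × Fin 3) × List (Fin 25 × (ℤ × ℤ × ℤ))) := [
    ((0, 0), [(0, (-1, 0, 0)), (1, (0, 0, 0))]),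
    ((1, 1), [(0, (0, -1, 0)), (1, (1, -1, 0))]),
    ((0, 1), [(1, (0, -1, 0)), (2, (0, 0, 0))]),
    ((0, 1), [(2, (-1, 0, -1)), (3, (0, 0, -1)), (4, (0, 0, 0))]),
    ((0, 1), [(2, (-1, 0, 0)), (3, (0, 0, 0))]),
    ((0, 1), [(3, (0, 0, -1)), (8, (0, 0, 0)), (17, (-1, 0, -1))]),
    ((0, 1), [(3, (0, 0, -1)), (8, (0, 0, 0)), (23, (-1, 0, -1))]),
    ((0, 1), [(3, (0, 0, -1)), (10, (-1, 0, -1)), (11, (0, 0, 0))]),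
    ((0, 1), [(3, (0, 0, -1)), (13, (-1, 0, -1)), (14, (0, 0, 0))]),
    ((0, 1), [(3, (0, 0, 0)), (13, (-1, 0, 0))]),
    ((0, 1), [(5, (0, -1, 0)), (6, (0, 0, 0))]),
    ((0, 1), [(6, (-1, 0, 0)), (8, (0, 0, 0))]),
    ((0, 1), [(8, (0, 0, 0)), (12, (0, -1, 0))]),
    ((0, 1), [(8, (0, 0, 0)), (19, (0, -1, 0))]),
    ((0, 1), [(8, (0, 0, 0)), (21, (-1, 0, 0))]),
    ((0, 1), [(9, (0, -1, 0)), (10, (0, 0, 0))]),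
    ((0, 2), [(1, (0, 0, -1)), (2, (0, 1, -1))]),
    ((0, 2), [(3, (0, 0, -1)), (4, (0, 0, 0))]),
    ((0, 2), [(3, (0, 0, -1)), (8, (0, 0, 0))]),
    ((0, 2), [(3, (0, 0, -1)), (11, (0, 0, 0))]),
    ((0, 2), [(3, (0, 0, -1)), (14, (0, 0, 0))]),
    ((0, 2), [(4, (-1, 0, 0)), (5, (0, 0, 0))]),
    ((0, 2), [(5, (0, -1, 0)), (6, (0, 0, 0))]),
    ((0, 2), [(5, (0, 0, 0)), (18, (-1, 0, 0))]),
    ((0, 2), [(6, (-1, 0, 0)), (8, (0, 0, 0))]),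
    ((0, 2), [(8, (0, 0, 0)), (12, (0, -1, 0))]),
    ((0, 2), [(9, (0, 0, -1)), (10, (0, 1, -1))]),
    ((0, 2), [(11, (0, 0, 0)), (20, (0, 0, -1))]),
    ((0, 2), [(14, (-1, 0, 0)), (15, (0, 0, 0))]),
    ((0, 2), [(15, (0, 0, 0)), (22, (-1, 0, 0))]),
    ((0, 2), [(16, (0, 0, -1)), (17, (0, 1, -1))]),
    ((1, 2), [(2, (0, 0, -1)), (3, (1, 0, -1))]),
    ((1, 2), [(3, (1, 0, -1)), (10, (0, 0, -1))]),
    ((1, 2), [(3, (1, 0, -1)), (13, (0, 0, -1))]),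
    ((1, 2), [(3, (1, 0, -1)), (17, (0, 0, -1))]),
    ((1, 2), [(3, (1, 0, -1)), (23, (0, 0, -1))]),
    ((1, 2), [(4, (0, -1, 0)), (5, (1, -1, 0))]),
    ((1, 2), [(5, (0, -1, 0)), (6, (0, 0, 0))]),
    ((1, 2), [(5, (1, -1, 0)), (18, (0, -1, 0))]),
    ((1, 2), [(6, (0, 0, 0)), (15, (0, -1, 0))]),
    ((1, 2), [(11, (0, -1, 0)), (12, (1, -1, 0))]),
    ((1, 2), [(12, (1, -1, 0)), (24, (0, -1, 0))])]

/-- The offset rule is the identity `M (p + d) + a = (M p - e) + (M d + a + e)`, with `a` and `e` in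
the first coordinate. Each pair kept in `Z` needs just one predecessor in `Y`, with a digit of its
own. -/
theorem offsetFamily_step : ∀ Y ∈ offsetFamily, ∀ e ∈ unborderedEdges, e.1 = Y.1 →
    ∃ Z ∈ offsetFamily, Z.1 = e.2.1 ∧ ∀ z ∈ Z.2, ∃ y ∈ Y.2, ∃ a : Fin 2,
      tribUnborderedDFA.step y.1 a = z.1 ∧
      z.2 = tribMat y.2 + ((a.val : ℤ), 0, 0) + (e.2.2, 0, 0) := by
  decide +kernel

theorem exists_accept_of_mem_offsetFamily : ∀ Y ∈ offsetFamily,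
    ∃ y ∈ Y.2, y.1 ∈ tribUnborderedDFA.accept ∧ vecSum y.2 = 0 := by
  have : ∀ Y ∈ offsetFamily, ∃ y ∈ Y.2,
      y.1 ∈ ({0, 1, 2, 3, 4, 5, 6, 8, 10, 11, 12, 14, 15, 17} : Finset (Fin 25)) ∧
        vecSum y.2 = 0 := by
    decide +kernel
  intro Y hY
  obtain ⟨y, hy, h1, h2⟩ := this Y hY
  exact ⟨y, hy, by simpa [tribUnborderedDFA] using h1, h2⟩

theorem UnborderedVec.exists_offsetFamily {g : Fin 3 × Fin 3} {p : ℤ × ℤ × ℤ}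
    (h : UnborderedVec g p) : ∃ Y ∈ offsetFamily, Y.1 = g ∧ ∀ y ∈ Y.2, ∃ w : List (Fin 2),
      tribUnborderedDFA.eval w = y.1 ∧ digitVec w = p + y.2 := by
  induction h with
  | zero =>
    refine ⟨((0, 0), [(0, (-1, 0, 0)), (1, (0, 0, 0))]), by decide, rfl, fun y hy => ?_⟩
    simp only [List.mem_cons, List.not_mem_nil, or_false] at hy
    rcases hy with rfl | rfl
    · exact ⟨[], rfl, rfl⟩
    · exact ⟨[1], rfl, rfl⟩
  | one =>
    refine ⟨((1, 1), [(0, (0, -1, 0)), (1, (1, -1, 0))]), by decide, rfl, fun y hy => ?_⟩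
    simp only [List.mem_cons, List.not_mem_nil, or_false] at hy
    rcases hy with rfl | rfl
    · exact ⟨[], rfl, rfl⟩
    · exact ⟨[1], rfl, rfl⟩
  | @step s t e p h hp ih =>
    obtain ⟨Y, hY, rfl, ih⟩ := ih
    obtain ⟨Z, hZ, h1, h2⟩ := offsetFamily_step Y hY _ h rfl
    refine ⟨Z, hZ, h1, fun z hz => ?_⟩
    obtain ⟨y, hy, a, h3, h4⟩ := h2 z hz
    obtain ⟨w, hw1, hw2⟩ := ih y hy
    refine ⟨w ++ [a], by rw [DFA.eval_append_singleton, hw1, h3], ?_⟩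
    rw [digitVec_append_singleton, hw2, h4, tribMat_add]
    dsimp only
    abel

theorem evalFrom_dead (w : List (Fin 2)) : tribUnborderedDFA.evalFrom 7 w = 7 := by
  have h : ∀ a : Fin 2, tribUnborderedDFA.step 7 a = 7 := by decide
  induction w with
  | nil => rfl
  | cons a w ih => rw [DFA.evalFrom_cons, h, ih]

/-- The digits `111` lead from every state to the dead state. This makes the words found through
`offsetFamily` canonical up to leading zeros. -/
theorem not_infix_of_accepts {w : List (Fin 2)} (h : w ∈ tribUnborderedDFA.accepts) :
    ¬ [1, 1, 1] <:+: w := by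
  rintro ⟨s, t, rfl⟩
  have h7 : ∀ q : Fin 25, tribUnborderedDFA.evalFrom q [1, 1, 1] = 7 := by decide +kernel
  rw [DFA.mem_accepts, DFA.eval, DFA.evalFrom_of_append, DFA.evalFrom_of_append, h7,
    evalFrom_dead] at h
  simp [tribUnborderedDFA] at h

/-- The initial state loops on the digit `0`. -/
theorem eval_dropWhile (w : List (Fin 2)) :
    tribUnborderedDFA.eval (w.dropWhile (· == 0)) = tribUnborderedDFA.eval w := by
  induction w with
  | nil => rfl
  | cons a w ih =>
    rw [List.dropWhile_cons]
    split_ifs with ha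
    · have : a = 0 := by simpa using ha
      rw [ih, this]
      rfl
    · rfl

theorem tribRep_tribVal {w : List (Fin 2)} (h : ¬ [1, 1, 1] <:+: w) :
    tribRep (tribVal w) = w.dropWhile (· == 0) := by
  refine (tribRep_eq_iff _ _).2 ⟨⟨fun h0 => ?_, fun h3 => ?_⟩, tribVal_dropWhile w⟩
  · have := List.head?_dropWhile_not (fun a : Fin 2 => a == 0) w
    rw [h0] at this
    simp at this
  · exact h (h3.trans (List.dropWhile_suffix _).isInfix)

theorem tribRep_mem_accepts_of_unborderedVec {g : Fin 3 × Fin 3} {p : ℤ × ℤ × ℤ}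
    (h : UnborderedVec g p) {n : ℕ} (hn : vecSum p = n) :
    tribRep n ∈ tribUnborderedDFA.accepts := by
  obtain ⟨Y, hY, -, hw⟩ := h.exists_offsetFamily
  obtain ⟨y, hy, hacc, hy0⟩ := exists_accept_of_mem_offsetFamily Y hY
  obtain ⟨w, hw1, hw2⟩ := hw y hy
  have hval : tribVal w = n := by
    have := vecSum_digitVec w
    rw [hw2, vecSum_add, hy0, add_zero, hn] at this
    exact_mod_cast this.symm
  have hmem : w ∈ tribUnborderedDFA.accepts := by rwa [DFA.mem_accepts, hw1]
  rw [← hval, tribRep_tribVal (not_infix_of_accepts hmem), DFA.mem_accepts, eval_dropWhile]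
  exact hmem

theorem theorem14 (n : ℕ) :
    (∃ x : List (Fin 3), IsTribFactor x ∧ x.length = n ∧ IsUnbordered x) ↔
      tribRep n ∈ tribUnborderedDFA.accepts := by
  rcases eq_or_ne n 0 with rfl | hn
  -- The empty word is treated apart, since the generated vectors only describe nonempty factors.
  · refine iff_of_true ⟨[], ⟨0, rfl⟩, rfl, ?_⟩ ?_
    · rintro ⟨y, h0, -, h1, -⟩
      exact h0 (List.prefix_nil.1 h1)
    · exact Or.inl rfl
  · rw [exists_isUnbordered_iff hn]
    constructor
    · rintro ⟨g, p, h, hp⟩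
      exact tribRep_mem_accepts_of_unborderedVec h hp
    · intro h
      have := exists_unborderedVec_of_accepts h (by rwa [tribVal_tribRep])
      rwa [tribVal_tribRep] at this
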